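/- Let $d\ge 2$ and let $J=(J_b)$ be a realization of real couplings on the nearest-neighbour edges $b$ of $\mathbb Z^d$. For $m\in\mathbb N$ identify the cube $\{-m,\dots,m\}^d$ with the discrete torus of side $2m+1$; let $K$ be couplings on the torus edges that equal $J$ on the edges of the cube, the couplings of the wrap-around edges being arbitrary (they encode the spin-symmetric boundary condition: free, periodic, antiperiodic, ...). A finite-volume ground state pair $\{\sigma,-\sigma\}$ minimizes $-\sum_{\langle x,y\rangle}K_{xy}\sigma_x\sigma_y$. The critical droplet boundary $\partial D(b,\sigma)$ of an edge $b$ is a surface (the set of edges joining a set $D$ of sites to its complement) that has least energy $\sum_{\langle x,y\rangle\in\partial D}K_{xy}\sigma_x\sigma_y$ among the surfaces containing $b$. The critical value $J_c^\sigma(b)$ is the value of the coupling of $b$ for which, all other couplings being fixed, the energy of $\partial D(b,\sigma)$ vanishes. An infinite-volume ground state pair $\sigma$ with critical values $J_c^\sigma(b)$ is a limit of finite-volume ground state pairs along a sequence of such cubes with $m\to\infty$, where all relative spin orientations $\sigma_x\sigma_y$ and the critical values of all edges converge. The flexibility of $b$ is $f(b,\sigma)=|J_b-J_c^\sigma(b)|$,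 and the bond-averaged flexibility $\langle f\rangle$ is the limit, when it exists, of the averages of $f(b,\sigma)$ over the edges of $\{-N,\dots,N\}^d$ as $N\to\infty$. Fix a sequence of cubes with boundary conditions and an edge $b_0$, and let the coupling of $b_0$ take the values $t\in T\subseteq\mathbb R$, all other couplings (including boundary ones) being held fixed. For each $t\in T$ let $\sigma^t$ be the infinite-volume ground state pair for these couplings obtained along the given sequence, and write $f_t(b)=f(b,\sigma^t)$. Then there is a number $c$ (the critical value of $b_0$) such that: 1. $J_c^{\sigma^t}(b_0)=c$ and $f_t(b_0)=|t-c|$ for all $t\in T$. 2. $|f_{t'}(b)-f_t(b)|\le|t'-t|$ for all $t,t'\in T$ and all edges $b$, whether or not $c$ lies between $t$ and $t'$. 3. If $t,t'\in T$ lie on the same side of $c$ (possibly at $c$), then $|f_{t'}(b_0)-f_t(b_0)|=|t'-t|$, so that $|f_{t'}(b)-f_t(b)|\le|f_{t'}(b_0)-f_t(b_0)|$ for all edges $b$. 4. For all $t,t'\in T$ and all $N$, the averages of $f_{t'}$ and of $f_t$ over the edges of $\{-N,\dots,N\}^d$ differ by at most $|t'-t|$. If $\langle f_t\rangle$ exists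 for all $t$ in a set $S\subseteq T$, then $t\mapsto\langle f_t\rangle$ is on $S$ the restriction of a $1$-Lipschitz, hence continuous, function on $\mathbb R$; in particular it has no jump at $c$. -/

import Mathlib

open Filter Topology

namespace SpinGlass

/-- Nearest-neighbour edges of the lattice `R ^ d` (`R = ℤ` for the infinite lattice,
`R = ZMod (2 * m + 1)` for the discrete torus): the pair `(x, i)` is the edge joining the site `x`
to the site `x + e_i`. -/
abbrev Edge (R : Type) (d : ℕ) : Type := (Fin d → R) × Fin d

/-- The second endpoint `x + e_i` of the edge `(x, i)`. -/
def Edge.head {R : Type} [Ring R] {d : ℕ} (e : Edge R d) : Fin d → R :=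
  e.1 + Pi.single e.2 1

/-- Real value of an Ising spin. -/
def spin (s : ℤˣ) : ℝ := ((s : ℤ) : ℝ)

/-! ### Finite volume

The cube `{-m, …, m} ^ d` is identified with the torus `(ZMod (2 * m + 1)) ^ d`. The edges of the
torus are the edges of the cube together with the wrap-around edges, and a coupling is attached to
each of them. -/

/-- The Edwards-Anderson Hamiltonian `-∑ K_{xy} σ_x σ_y`. -/
def energy {d m : ℕ} (K : Edge (ZMod (2 * m + 1)) d → ℝ)
    (σ : (Fin d → ZMod (2 * m + 1)) → ℤˣ) : ℝ :=
  -∑ e, K e * spin (σ e.1) * spin (σ e.head)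

/-- `σ` (equivalently the pair `{σ, -σ}`) is a ground state for the couplings `K`. -/
def IsGroundState {d m : ℕ} (K : Edge (ZMod (2 * m + 1)) d → ℝ)
    (σ : (Fin d → ZMod (2 * m + 1)) → ℤˣ) : Prop :=
  ∀ τ, energy K σ ≤ energy K τ

/-- The boundary `∂D` of a set `D` of sites: the edges joining `D` to its complement. -/
def boundary {d m : ℕ} (D : Finset (Fin d → ZMod (2 * m + 1))) :
    Finset (Edge (ZMod (2 * m + 1)) d) :=
  Finset.univ.filter fun e => ¬(e.1 ∈ D ↔ e.head ∈ D)

/-- The energy `∑_{⟨x,y⟩ ∈ ∂D} K_{xy} σ_x σ_y` of the surface `∂D` in `σ`. -/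
def surfaceEnergy {d m : ℕ} (K : Edge (ZMod (2 * m + 1)) d → ℝ)
    (σ : (Fin d → ZMod (2 * m + 1)) → ℤˣ) (D : Finset (Fin d → ZMod (2 * m + 1))) : ℝ :=
  ∑ e ∈ boundary D, K e * spin (σ e.1) * spin (σ e.head)

/-- `D` is a critical droplet of the edge `b` in `σ`: its boundary has least energy among all
surfaces that contain `b` and split the sites into two parts. -/
def IsCriticalDroplet {d m : ℕ} (K : Edge (ZMod (2 * m + 1)) d → ℝ)
    (σ : (Fin d → ZMod (2 * m + 1)) → ℤˣ) (b : Edge (ZMod (2 * m + 1)) d)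
    (D : Finset (Fin d → ZMod (2 * m + 1))) : Prop :=
  b ∈ boundary D ∧ ∀ D', b ∈ boundary D' → surfaceEnergy K σ D ≤ surfaceEnergy K σ D'

/-- `c` is the critical value of the coupling of `b` in `σ`: the value of that coupling at which,
all other couplings being held fixed, the energy of the critical droplet of `b` vanishes. -/
def IsCriticalValue {d m : ℕ} (K : Edge (ZMod (2 * m + 1)) d → ℝ)
    (σ : (Fin d → ZMod (2 * m + 1)) → ℤˣ) (b : Edge (ZMod (2 * m + 1)) d) (c : ℝ) : Prop :=
  ∃ D, IsCriticalDroplet K σ b D ∧ surfaceEnergy (Function.update K b c) σ D = 0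

/-! ### Infinite volume -/

/-- The projection `ℤ ^ d → (ZMod (2 * m + 1)) ^ d`, a bijection from the cube to the torus. -/
def projSite {d : ℕ} (m : ℕ) (x : Fin d → ℤ) : Fin d → ZMod (2 * m + 1) := fun j => (x j : ℤ)

/-- The corresponding projection of edges. -/
def projEdge {d : ℕ} (m : ℕ) (e : Edge ℤ d) : Edge (ZMod (2 * m + 1)) d := (projSite m e.1, e.2)

/-- Both endpoints of the edge `e` lie in the cube `{-m, …, m} ^ d`. -/
def InBox {d : ℕ} (m : ℕ) (e : Edge ℤ d) : Prop :=
  (∀ j, |e.1 j| ≤ (m : ℤ)) ∧ ∀ j, |e.head j| ≤ (m : ℤ)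

/-- A sequence of cubes increasing to the whole lattice, each carrying couplings. -/
structure VolumeSeq (d : ℕ) where
  m : ℕ → ℕ
  tendsto_m : Tendsto m atTop atTop
  K : (n : ℕ) → Edge (ZMod (2 * m n + 1)) d → ℝ

/-- Inside each cube the couplings are those of the realization `J`. The couplings of the
wrap-around edges are unrestricted; they encode the spin-symmetric boundary condition (for free
boundary conditions they vanish, for periodic and antiperiodic ones they do not). -/
def VolumeSeq.Approximates {d : ℕ} (V : VolumeSeq d) (J : Edge ℤ d → ℝ) : Prop :=
  ∀ n e, InBox (V.m n) e → V.K n (projEdge (V.m n) e) = J e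

open Classical in
/-- The same volumes and boundary conditions, with the coupling of the edge `b₀` set to `t` (in
the cubes that contain `b₀`). -/
noncomputable def VolumeSeq.vary {d : ℕ} (V : VolumeSeq d) (b₀ : Edge ℤ d) (t : ℝ) :
    VolumeSeq d where
  m := V.m
  tendsto_m := V.tendsto_m
  K n := if InBox (V.m n) b₀ then Function.update (V.K n) (projEdge (V.m n) b₀) t else V.K n

/-- The ground state pair `{σ, -σ}` on `ℤ ^ d`, with critical values `Jc b` (`b` an edge), is the
infinite-volume limit of finite-volume ground state pairs along the volumes `V`: relative spin
orientations and critical values of the couplings converge. -/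
def IsInfiniteGSP {d : ℕ} (V : VolumeSeq d) (σ : (Fin d → ℤ) → ℤˣ) (Jc : Edge ℤ d → ℝ) : Prop :=
  ∃ (s : (n : ℕ) → (Fin d → ZMod (2 * V.m n + 1)) → ℤˣ) (c : ℕ → Edge ℤ d → ℝ),
    (∀ n, IsGroundState (V.K n) (s n)) ∧
    (∀ x y, ∀ᶠ n in atTop,
      s n (projSite (V.m n) x) * s n (projSite (V.m n) y) = σ x * σ y) ∧
    (∀ b, ∀ᶠ n in atTop, IsCriticalValue (V.K n) (s n) (projEdge (V.m n) b) (c n b)) ∧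
    ∀ b, Tendsto (fun n => c n b) atTop (𝓝 (Jc b))

/-- The flexibility `|J(b) - J_c(b)|` of the edge `b`. -/
def flexibility {d : ℕ} (J Jc : Edge ℤ d → ℝ) (b : Edge ℤ d) : ℝ := |J b - Jc b|

/-- The edges with both endpoints in `{-N, …, N} ^ d`. -/
noncomputable def edgeBox (d N : ℕ) : Finset (Edge ℤ d) :=
  ((Fintype.piFinset fun _ : Fin d => Finset.Icc (-(N : ℤ)) N) ×ˢ Finset.univ).filter
    fun e => e.1 e.2 + 1 ≤ (N : ℤ)

/-- The average of a function of the edges over the cube `{-N, …, N} ^ d`. -/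
noncomputable def boxAverage {d : ℕ} (f : Edge ℤ d → ℝ) (N : ℕ) : ℝ :=
  (∑ e ∈ edgeBox d N, f e) / ((edgeBox d N).card : ℝ)

/-- `a` is the average `⟨f⟩` of `f` over all edges of the lattice. -/
def IsBondAverage {d : ℕ} (f : Edge ℤ d → ℝ) (a : ℝ) : Prop :=
  Tendsto (boxAverage f) atTop (𝓝 a)

/-! Consistency of the definitions. -/

theorem mem_edgeBox {d N : ℕ} (e : Edge ℤ d) : e ∈ edgeBox d N ↔ InBox N e := by
  simp only [edgeBox, InBox, Edge.head, Finset.mem_filter, Finset.mem_product,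
    Fintype.mem_piFinset, Finset.mem_Icc, Finset.mem_univ, and_true, abs_le, Pi.add_apply]
  refine and_congr_right fun h => ⟨fun h1 j => ?_, fun h1 => ?_⟩
  · by_cases hj : j = e.2
    · subst hj
      have := h e.2
      simp only [Pi.single_eq_same]
      omega
    · simpa [Pi.single_eq_of_ne hj] using h j
  · simpa using (h1 e.2).2

theorem projEdge_injOn {d m : ℕ} {e e' : Edge ℤ d} (h : InBox m e) (h' : InBox m e')
    (he : projEdge m e = projEdge m e') : e = e' := by
  have h1 := congrArg Prod.fst he
  have h2 := congrArg Prod.snd he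
  refine Prod.ext (funext fun j => ?_) h2
  have h3 := congrFun h1 j
  simp only [projEdge, projSite] at h3
  rw [ZMod.intCast_eq_intCast_iff_dvd_sub] at h3
  obtain ⟨k, hk⟩ := h3
  have a1 := abs_le.1 (h.1 j)
  have a2 := abs_le.1 (h'.1 j)
  have a3 : |e'.1 j - e.1 j| < ((2 * m + 1 : ℕ) : ℤ) := by
    rw [abs_lt]; push_cast; constructor <;> linarith
  have := Int.eq_zero_of_abs_lt_dvd ⟨k, hk⟩ a3
  linarith

open Classical in
theorem VolumeSeq.Approximates.vary {d : ℕ} {V : VolumeSeq d} {J : Edge ℤ d → ℝ}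
    (hV : V.Approximates J) (b₀ : Edge ℤ d) (t : ℝ) :
    (V.vary b₀ t).Approximates (Function.update J b₀ t) := by
  intro n e he
  change InBox (V.m n) e at he
  change (if InBox (V.m n) b₀ then Function.update (V.K n) (projEdge (V.m n) b₀) t
    else V.K n) (projEdge (V.m n) e) = _
  by_cases heq : e = b₀
  · subst heq
    rw [if_pos he, Function.update_self, Function.update_self]
  · rw [Function.update_of_ne heq]
    split_ifs with hb
    · rw [Function.update_of_ne (fun hh => heq (projEdge_injOn he hb hh))]
      exact hV n e he
    · exact hV n e he

end SpinGlass

/-!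
The argument rests on one finite-volume identity. For an edge `b` let `p` and `q` be the least
energies among the spin configurations whose spins at the two ends of `b` are parallel,
respectively antiparallel. Flipping the spins of a ground state `σ` in a set `D` raises the energy
by twice the energy of the surface `∂D`, and reverses the relative orientation across `b` exactly
when `b ∈ ∂D`. Hence `σ` and the flip of its critical droplet attain the two constrained minima, in
one order or the other, and the sign of `σ` across `b` makes both orders give the same equation
`K b - c = (q - p) / 2` (`IsGroundState.exists_isLeast_of_isCriticalValue`). In particular the
critical value depends on the couplings alone, not on the ground state.

When the coupling of `b₀` moves from `t` to `t'`, the energy of a configuration moves by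
`-(t' - t)` times its relative orientation across `b₀`. So both minima, and with them
`K b - c`, move by at most `|t' - t|` (`abs_coupling_sub_criticalValue_sub_le`). For `b = b₀` the
orientation is constant on each constraint set, so `p` moves by `-(t' - t)`, `q` by `t' - t`, and
`c` stays fixed (`criticalValue_update_self_eq`). Both facts survive the infinite-volume limit.
The signed quantity `J b - J_c b` is thus Lipschitz whether or not the critical point is crossed,
which yields the bounds on flexibilities, on their averages and on the limits of the averages.
-/

namespace SpinGlass

/-! ### Relative orientations and droplet flips -/

/-- The relative orientation `σ_x σ_y` of the spins at the two ends of the edge `e`. -/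
def bond {R : Type} [Ring R] {d : ℕ} (σ : (Fin d → R) → ℤˣ) (e : Edge R d) : ℤˣ :=
  σ e.1 * σ e.head

theorem spin_mul (a b : ℤˣ) : spin (a * b) = spin a * spin b := by
  simp [spin]

theorem spin_neg (a : ℤˣ) : spin (-a) = -spin a := by
  simp [spin]

theorem abs_spin (a : ℤˣ) : |spin a| = 1 := by
  rcases Int.units_eq_one_or a with rfl | rfl <;> simp [spin]

section FiniteVolume

variable {d m : ℕ}

/-- The configuration `σ` with the spins in `D` reversed. -/
def flip (σ : (Fin d → ZMod (2 * m + 1)) → ℤˣ) (D : Finset (Fin d → ZMod (2 * m + 1))) :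
    (Fin d → ZMod (2 * m + 1)) → ℤˣ :=
  fun x => if x ∈ D then -σ x else σ x

theorem bond_flip (σ : (Fin d → ZMod (2 * m + 1)) → ℤˣ)
    (D : Finset (Fin d → ZMod (2 * m + 1))) (e : Edge (ZMod (2 * m + 1)) d) :
    bond (flip σ D) e = if e ∈ boundary D then -bond σ e else bond σ e := by
  by_cases h1 : e.1 ∈ D <;> by_cases h2 : e.head ∈ D <;> simp [bond, flip, boundary, h1, h2]

theorem exists_flip_eq (σ τ : (Fin d → ZMod (2 * m + 1)) → ℤˣ) : ∃ D, flip σ D = τ := by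
  refine ⟨Finset.univ.filter fun x => τ x ≠ σ x, funext fun x => ?_⟩
  by_cases h : τ x = σ x
  · simp [flip, h]
  · rcases Int.units_eq_one_or (τ x) with h1 | h1 <;>
      rcases Int.units_eq_one_or (σ x) with h2 | h2 <;> simp_all [flip]

theorem energy_eq_sum_bond (K : Edge (ZMod (2 * m + 1)) d → ℝ)
    (σ : (Fin d → ZMod (2 * m + 1)) → ℤˣ) : energy K σ = -∑ e, K e * spin (bond σ e) := by
  simp only [energy, bond, spin_mul, mul_assoc]

theorem surfaceEnergy_eq_sum_bond (K : Edge (ZMod (2 * m + 1)) d → ℝ)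
    (σ : (Fin d → ZMod (2 * m + 1)) → ℤˣ) (D : Finset (Fin d → ZMod (2 * m + 1))) :
    surfaceEnergy K σ D = ∑ e ∈ boundary D, K e * spin (bond σ e) := by
  simp only [surfaceEnergy, bond, spin_mul, mul_assoc]

theorem energy_flip (K : Edge (ZMod (2 * m + 1)) d → ℝ)
    (σ : (Fin d → ZMod (2 * m + 1)) → ℤˣ) (D : Finset (Fin d → ZMod (2 * m + 1))) :
    energy K (flip σ D) = energy K σ + 2 * surfaceEnergy K σ D := by
  have h : ∀ e, K e * spin (bond (flip σ D) e) = K e * spin (bond σ e)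
      - 2 * (if e ∈ boundary D then K e * spin (bond σ e) else 0) := by
    intro e
    rw [bond_flip]
    split_ifs
    · rw [spin_neg]; ring
    · ring
  rw [energy_eq_sum_bond, energy_eq_sum_bond, surfaceEnergy_eq_sum_bond, Finset.sum_congr rfl
    fun e _ => h e, Finset.sum_sub_distrib, ← Finset.mul_sum, Finset.sum_ite_mem,
    Finset.univ_inter]
  ring

/-! ### Dependence of energies on one coupling -/

theorem sum_update_mul {ι : Type*} [DecidableEq ι] (s : Finset ι) {b : ι} (hb : b ∈ s)
    (K g : ι → ℝ) (t : ℝ) :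
    ∑ e ∈ s, Function.update K b t e * g e = ∑ e ∈ s, K e * g e + (t - K b) * g b := by
  rw [← Finset.add_sum_erase _ _ hb, ← Finset.add_sum_erase s (fun e => K e * g e) hb,
    Function.update_self, Finset.sum_congr rfl fun e he => by
      rw [Function.update_of_ne (Finset.ne_of_mem_erase he)]]
  ring

theorem energy_update (K : Edge (ZMod (2 * m + 1)) d → ℝ) (b : Edge (ZMod (2 * m + 1)) d)
    (t : ℝ) (τ : (Fin d → ZMod (2 * m + 1)) → ℤˣ) :
    energy (Function.update K b t) τ = energy K τ - (t - K b) * spin (bond τ b) := by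
  rw [energy_eq_sum_bond, energy_eq_sum_bond, sum_update_mul _ (Finset.mem_univ b)]
  ring

theorem energy_update_sub_energy_update (K : Edge (ZMod (2 * m + 1)) d → ℝ)
    (b : Edge (ZMod (2 * m + 1)) d) (t t' : ℝ) (τ : (Fin d → ZMod (2 * m + 1)) → ℤˣ) :
    energy (Function.update K b t') τ - energy (Function.update K b t) τ
      = -((t' - t) * spin (bond τ b)) := by
  rw [energy_update, energy_update]
  ring

theorem surfaceEnergy_update (K : Edge (ZMod (2 * m + 1)) d → ℝ)
    {b : Edge (ZMod (2 * m + 1)) d} {D : Finset (Fin d → ZMod (2 * m + 1))}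
    (hb : b ∈ boundary D) (t : ℝ) (σ : (Fin d → ZMod (2 * m + 1)) → ℤˣ) :
    surfaceEnergy (Function.update K b t) σ D
      = surfaceEnergy K σ D + (t - K b) * spin (bond σ b) := by
  rw [surfaceEnergy_eq_sum_bond, surfaceEnergy_eq_sum_bond, sum_update_mul _ hb]

/-! ### Critical values as differences of constrained minima -/

/-- The energies of the configurations with prescribed relative orientation `u` across `b`. -/
def constrainedEnergies (K : Edge (ZMod (2 * m + 1)) d → ℝ) (b : Edge (ZMod (2 * m + 1)) d)
    (u : ℤˣ) : Set ℝ :=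
  energy K '' {τ | bond τ b = u}

theorem IsGroundState.isLeast_constrainedEnergies {K : Edge (ZMod (2 * m + 1)) d → ℝ}
    {σ : (Fin d → ZMod (2 * m + 1)) → ℤˣ} (hσ : IsGroundState K σ)
    (b : Edge (ZMod (2 * m + 1)) d) :
    IsLeast (constrainedEnergies K b (bond σ b)) (energy K σ) :=
  ⟨⟨σ, rfl, rfl⟩, by rintro _ ⟨τ, -, rfl⟩; exact hσ τ⟩

theorem IsCriticalDroplet.isLeast_constrainedEnergies {K : Edge (ZMod (2 * m + 1)) d → ℝ}
    {σ : (Fin d → ZMod (2 * m + 1)) → ℤˣ} {b : Edge (ZMod (2 * m + 1)) d}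
    {D : Finset (Fin d → ZMod (2 * m + 1))} (hD : IsCriticalDroplet K σ b D) :
    IsLeast (constrainedEnergies K b (-bond σ b)) (energy K (flip σ D)) := by
  refine ⟨⟨flip σ D, ?_, rfl⟩, ?_⟩
  · rw [Set.mem_ofPred_eq, bond_flip, if_pos hD.1]
  · rintro _ ⟨τ, hτ, rfl⟩
    obtain ⟨D', rfl⟩ := exists_flip_eq σ τ
    have hb : b ∈ boundary D' := by
      by_contra hb
      rw [Set.mem_ofPred_eq, bond_flip, if_neg hb] at hτ
      exact units_ne_neg_self _ hτ
    rw [energy_flip, energy_flip]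
    linarith [hD.2 D' hb]

/-- The critical value is determined by the two constrained minimal energies: the ground state
attains one of them and the flip of its critical droplet the other. -/
theorem IsGroundState.exists_isLeast_of_isCriticalValue {K : Edge (ZMod (2 * m + 1)) d → ℝ}
    {σ : (Fin d → ZMod (2 * m + 1)) → ℤˣ} (hσ : IsGroundState K σ)
    {b : Edge (ZMod (2 * m + 1)) d} {c : ℝ} (hc : IsCriticalValue K σ b c) :
    ∃ p q, IsLeast (constrainedEnergies K b 1) p ∧ IsLeast (constrainedEnergies K b (-1)) q ∧
      K b - c = (q - p) / 2 := by
  obtain ⟨D, hD, h0⟩ := hc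
  have h1 := hσ.isLeast_constrainedEnergies b
  have h2 := hD.isLeast_constrainedEnergies
  have h3 := energy_flip K σ D
  rw [surfaceEnergy_update K hD.1] at h0
  rcases Int.units_eq_one_or (bond σ b) with h | h <;> rw [h] at h0 h1 h2
  · refine ⟨_, _, h1, h2, ?_⟩
    simp only [spin, Units.val_one, Int.cast_one] at h0
    linarith
  · rw [neg_neg] at h2
    refine ⟨_, _, h2, h1, ?_⟩
    simp only [spin, Units.val_neg, Units.val_one, Int.cast_neg, Int.cast_one] at h0
    linarith

theorem isLeast_image_sub_le {α : Type*} {s : Set α} {E E' : α → ℝ} {p p' δ : ℝ}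
    (hp : IsLeast (E '' s) p) (hp' : IsLeast (E' '' s) p')
    (h : ∀ x ∈ s, E' x - E x ≤ δ) : p' - p ≤ δ := by
  obtain ⟨x, hx, rfl⟩ := hp.1
  linarith [hp'.2 ⟨x, hx, rfl⟩, h x hx]

variable {K : Edge (ZMod (2 * m + 1)) d → ℝ} {b₀ : Edge (ZMod (2 * m + 1)) d} {t t' : ℝ}
  {σ σ' : (Fin d → ZMod (2 * m + 1)) → ℤˣ}

/-- The critical value of an edge does not depend on the coupling of that edge. -/
theorem criticalValue_update_self_eq {c c' : ℝ}
    (hσ : IsGroundState (Function.update K b₀ t) σ)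
    (hσ' : IsGroundState (Function.update K b₀ t') σ')
    (hc : IsCriticalValue (Function.update K b₀ t) σ b₀ c)
    (hc' : IsCriticalValue (Function.update K b₀ t') σ' b₀ c') : c' = c := by
  obtain ⟨p, q, hp, hq, h⟩ := hσ.exists_isLeast_of_isCriticalValue hc
  obtain ⟨p', q', hp', hq', h'⟩ := hσ'.exists_isLeast_of_isCriticalValue hc'
  have key : ∀ u : ℤˣ, ∀ s s' : ℝ, ∀ τ ∈ {τ | bond τ b₀ = u},
      energy (Function.update K b₀ s') τ - energy (Function.update K b₀ s) τ
        ≤ -((s' - s) * spin u) := by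
    rintro _ s s' τ rfl
    exact (energy_update_sub_energy_update K b₀ s s' τ).le
  have e1 := isLeast_image_sub_le hp hp' (key 1 t t')
  have e2 := isLeast_image_sub_le hp' hp (key 1 t' t)
  have e3 := isLeast_image_sub_le hq hq' (key (-1) t t')
  have e4 := isLeast_image_sub_le hq' hq (key (-1) t' t)
  simp only [spin, Units.val_neg, Units.val_one, Int.cast_neg, Int.cast_one] at e1 e2 e3 e4
  rw [Function.update_self] at h h'
  linarith

/-- The signed distance of a coupling from its critical value is `1`-Lipschitz in any one
coupling. -/
theorem abs_coupling_sub_criticalValue_sub_le {b : Edge (ZMod (2 * m + 1)) d} {c c' : ℝ}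
    (hσ : IsGroundState (Function.update K b₀ t) σ)
    (hσ' : IsGroundState (Function.update K b₀ t') σ')
    (hc : IsCriticalValue (Function.update K b₀ t) σ b c)
    (hc' : IsCriticalValue (Function.update K b₀ t') σ' b c') :
    |(Function.update K b₀ t' b - c') - (Function.update K b₀ t b - c)| ≤ |t' - t| := by
  obtain ⟨p, q, hp, hq, h⟩ := hσ.exists_isLeast_of_isCriticalValue hc
  obtain ⟨p', q', hp', hq', h'⟩ := hσ'.exists_isLeast_of_isCriticalValue hc'
  have key : ∀ u : ℤˣ, ∀ s s' : ℝ, ∀ τ ∈ {τ | bond τ b = u},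
      energy (Function.update K b₀ s') τ - energy (Function.update K b₀ s) τ ≤ |s' - s| := by
    intro u s s' τ _
    rw [energy_update_sub_energy_update]
    refine (neg_le_abs _).trans_eq ?_
    rw [abs_mul, abs_spin, mul_one]
  have e1 := isLeast_image_sub_le hp hp' (key 1 t t')
  have e2 := isLeast_image_sub_le hp' hp (key 1 t' t)
  have e3 := isLeast_image_sub_le hq hq' (key (-1) t t')
  have e4 := isLeast_image_sub_le hq' hq (key (-1) t' t)
  rw [abs_sub_comm t t'] at e2 e4
  rw [h, h', abs_le]
  constructor <;> linarith

end FiniteVolume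

/-! ### Passage to infinite volume -/

variable {d : ℕ}

theorem VolumeSeq.eventually_inBox (V : VolumeSeq d) (e : Edge ℤ d) :
    ∀ᶠ n in atTop, InBox (V.m n) e := by
  have h : ∀ z : ℤ, ∀ᶠ n in atTop, |z| ≤ (V.m n : ℤ) := fun z => by
    filter_upwards [V.tendsto_m.eventually_ge_atTop z.natAbs] with n hn
    rw [Int.abs_eq_natAbs]
    exact_mod_cast hn
  exact (eventually_all.2 fun j => h (e.1 j)).and (eventually_all.2 fun j => h (e.head j))

theorem VolumeSeq.vary_K_of_inBox {V : VolumeSeq d} {b₀ : Edge ℤ d} {n : ℕ}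
    (h : InBox (V.m n) b₀) (t : ℝ) :
    (V.vary b₀ t).K n = Function.update (V.K n) (projEdge (V.m n) b₀) t :=
  if_pos h

variable {V : VolumeSeq d} {b₀ : Edge ℤ d} {t t' : ℝ} {σ σ' : (Fin d → ℤ) → ℤˣ}
  {Jc Jc' : Edge ℤ d → ℝ}

theorem IsInfiniteGSP.criticalValue_eq (h : IsInfiniteGSP (V.vary b₀ t) σ Jc)
    (h' : IsInfiniteGSP (V.vary b₀ t') σ' Jc') : Jc' b₀ = Jc b₀ := by
  obtain ⟨s, c, hs, -, hc, hlim⟩ := h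
  obtain ⟨s', c', hs', -, hc', hlim'⟩ := h'
  refine tendsto_nhds_unique_of_eventuallyEq (hlim' b₀) (hlim b₀) ?_
  filter_upwards [hc b₀, hc' b₀, V.eventually_inBox b₀] with n hn hn' hb
  have g := hs n
  have g' := hs' n
  rw [VolumeSeq.vary_K_of_inBox hb] at g g' hn hn'
  exact criticalValue_update_self_eq g g' hn hn'

theorem IsInfiniteGSP.abs_coupling_sub_criticalValue_sub_le {J : Edge ℤ d → ℝ}
    (hV : V.Approximates J) (h : IsInfiniteGSP (V.vary b₀ t) σ Jc)
    (h' : IsInfiniteGSP (V.vary b₀ t') σ' Jc') (b : Edge ℤ d) :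
    |(Function.update J b₀ t' b - Jc' b) - (Function.update J b₀ t b - Jc b)| ≤ |t' - t| := by
  obtain ⟨s, c, hs, -, hc, hlim⟩ := h
  obtain ⟨s', c', hs', -, hc', hlim'⟩ := h'
  refine le_of_tendsto (((hlim' b).const_sub (Function.update J b₀ t' b)).sub
    ((hlim b).const_sub (Function.update J b₀ t b))).abs ?_
  filter_upwards [hc b, hc' b, V.eventually_inBox b₀, V.eventually_inBox b] with n hn hn' hb₀ hb
  have g := hs n
  have g' := hs' n
  have e := hV.vary b₀ t n b hb
  have e' := hV.vary b₀ t' n b hb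
  rw [VolumeSeq.vary_K_of_inBox hb₀] at g g' hn hn' e e'
  rw [← e, ← e']
  exact SpinGlass.abs_coupling_sub_criticalValue_sub_le g g' hn hn'

theorem IsInfiniteGSP.abs_flexibility_sub_le {J : Edge ℤ d → ℝ} (hV : V.Approximates J)
    (h : IsInfiniteGSP (V.vary b₀ t) σ Jc) (h' : IsInfiniteGSP (V.vary b₀ t') σ' Jc')
    (b : Edge ℤ d) :
    |flexibility (Function.update J b₀ t') Jc' b - flexibility (Function.update J b₀ t) Jc b|
      ≤ |t' - t| :=
  (abs_abs_sub_abs_le_abs_sub _ _).trans (h.abs_coupling_sub_criticalValue_sub_le hV h' b)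

/-! ### Averages -/

theorem abs_boxAverage_sub_le {f g : Edge ℤ d → ℝ} {δ : ℝ} (hδ : 0 ≤ δ)
    (h : ∀ b, |f b - g b| ≤ δ) (N : ℕ) : |boxAverage f N - boxAverage g N| ≤ δ := by
  rw [boxAverage, boxAverage, ← sub_div, ← Finset.sum_sub_distrib, abs_div, Nat.abs_cast]
  refine div_le_of_le_mul₀ (Nat.cast_nonneg _) hδ ((Finset.abs_sum_le_sum_abs _ _).trans ?_)
  refine (Finset.sum_le_card_nsmul _ _ δ fun b _ => h b).trans_eq ?_
  rw [nsmul_eq_mul, mul_comm]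

theorem IsBondAverage.abs_sub_le {f g : Edge ℤ d → ℝ} {α β δ : ℝ} (hf : IsBondAverage f α)
    (hg : IsBondAverage g β) (h : ∀ N, |boxAverage f N - boxAverage g N| ≤ δ) : |α - β| ≤ δ :=
  le_of_tendsto (Tendsto.sub hf hg).abs (Eventually.of_forall h)

end SpinGlass

theorem mainTheorem8 (d : ℕ) (hd : 2 ≤ d) (J : SpinGlass.Edge ℤ d → ℝ)
    (V : SpinGlass.VolumeSeq d) (hV : V.Approximates J) (b₀ : SpinGlass.Edge ℤ d)
    (T : Set ℝ) (σ : ℝ → (Fin d → ℤ) → ℤˣ) (Jc : ℝ → SpinGlass.Edge ℤ d → ℝ)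
    (f : ℝ → SpinGlass.Edge ℤ d → ℝ)
    (hσ : ∀ t ∈ T, SpinGlass.IsInfiniteGSP (V.vary b₀ t) (σ t) (Jc t))
    (hf : ∀ t ∈ T, f t = SpinGlass.flexibility (Function.update J b₀ t) (Jc t)) :
    ∃ c : ℝ,
      (∀ t ∈ T, Jc t b₀ = c ∧ f t b₀ = |t - c|) ∧
      (∀ t ∈ T, ∀ t' ∈ T, ∀ b, |f t' b - f t b| ≤ |t' - t|) ∧
      (∀ t ∈ T, ∀ t' ∈ T, (c ≤ t ∧ c ≤ t') ∨ (t ≤ c ∧ t' ≤ c) →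
        |f t' b₀ - f t b₀| = |t' - t| ∧ ∀ b, |f t' b - f t b| ≤ |f t' b₀ - f t b₀|) ∧
      (∀ t ∈ T, ∀ t' ∈ T, ∀ N,
        |SpinGlass.boxAverage (f t') N - SpinGlass.boxAverage (f t) N| ≤ |t' - t|) ∧
      (∀ S ⊆ T, ∀ a : ℝ → ℝ, (∀ t ∈ S, SpinGlass.IsBondAverage (f t) (a t)) →
        ∃ g : ℝ → ℝ, LipschitzWith 1 g ∧ Set.EqOn a g S) := by
  have hcrit : ∃ c, ∀ t ∈ T, Jc t b₀ = c := by
    rcases T.eq_empty_or_nonempty with rfl | ⟨t₀, ht₀⟩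
    · exact ⟨0, by simp⟩
    · exact ⟨Jc t₀ b₀, fun t ht => (hσ t₀ ht₀).criticalValue_eq (hσ t ht)⟩
  obtain ⟨c, hc⟩ := hcrit
  have hfc : ∀ t ∈ T, f t b₀ = |t - c| := fun t ht => by
    rw [hf t ht, SpinGlass.flexibility, Function.update_self, hc t ht]
  have hlip : ∀ t ∈ T, ∀ t' ∈ T, ∀ b, |f t' b - f t b| ≤ |t' - t| := fun t ht t' ht' b => by
    rw [hf t ht, hf t' ht']
    exact (hσ t ht).abs_flexibility_sub_le hV (hσ t' ht') b
  have havg : ∀ t ∈ T, ∀ t' ∈ T, ∀ N,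
      |SpinGlass.boxAverage (f t') N - SpinGlass.boxAverage (f t) N| ≤ |t' - t| :=
    fun t ht t' ht' => SpinGlass.abs_boxAverage_sub_le (abs_nonneg _) (hlip t ht t' ht')
  refine ⟨c, fun t ht => ⟨hc t ht, hfc t ht⟩, hlip, fun t ht t' ht' hside => ?_, havg,
    fun S hS a ha => ?_⟩
  · have heq : |f t' b₀ - f t b₀| = |t' - t| := by
      rw [hfc t ht, hfc t' ht']
      rcases hside with ⟨h, h'⟩ | ⟨h, h'⟩
      · rw [abs_of_nonneg (sub_nonneg.2 h), abs_of_nonneg (sub_nonneg.2 h'),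
          sub_sub_sub_cancel_right]
      · rw [abs_of_nonpos (sub_nonpos.2 h), abs_of_nonpos (sub_nonpos.2 h'), neg_sub, neg_sub,
          sub_sub_sub_cancel_left, abs_sub_comm]
    exact ⟨heq, fun b => heq ▸ hlip t ht t' ht' b⟩
  · refine LipschitzOnWith.extend_real (LipschitzOnWith.of_dist_le_mul fun t' ht' t ht => ?_)
    rw [NNReal.coe_one, one_mul, Real.dist_eq, Real.dist_eq]
    exact (ha t' ht').abs_sub_le (ha t ht) (havg t (hS ht) t' (hS ht'))
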